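/- **Sizes.** The size of a rational number $a=p/q$ in lowest terms is $\|a\| = 1+\lceil\log_2(|p|+1)\rceil+\lceil\log_2(|q|+1)\rceil$; an irrational real number has size $1$. A vector $v\in\mathbb{Q}^t$ has size $\|v\| = t+\sum_i\|v_i\|$. Let $\mathbb{Q}_{\le m}=\{a\in\mathbb{Q}: \|a\|\le m\}$. **Constraints.** A polynomial constraint (PC) $\alpha$ in $n$ variables is a positive Boolean combination (built with finite conjunctions and disjunctions, without negation) of atoms $p>0$ and $p\ge 0$ with $p\in\mathbb{R}[X_1,\dots,X_n]$. It is rational if all its polynomials have rational coefficients. $[\![\alpha]\!]\subseteq\mathbb{Q}^n$ is the set of rational points that satisfy $\alpha$, and $\deg\alpha$ is the largest total degree of a polynomial in $\alpha$ ($0$ if there is none). The size of a polynomial $p=\sum_{r\in\{0,\dots,k\}^n}c_rX^r$, with $k$ least possible, is $\sum_{r\in\{0,\dots,k\}^n}\bigl(\|c_r\|+\|r_1\|+\dots+\|r_n\|+n\bigr)$. Its sparse size is the same sum restricted to those $r$ with $c_r\ne 0$, and its shape size is the sparse size with every $\|c_r\|$ replaced by $1$. For each of these three measures, the size of an atom is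 that of its polynomial plus $1$, and the size of $\bigwedge_{i\le k}\beta_i$ or $\bigvee_{i\le k}\beta_i$ is $k$ plus the sum of the sizes of the $\beta_i$. Write $\mathrm{size}(\alpha)$, $\mathrm{sparse}(\alpha)$, $\mathrm{shape}(\alpha)$. **Vectors.** For $u,v\in\mathbb{R}^t$ write $u\sim_m v$ if for all $w\in(\mathbb{Q}_{\le m})^t$ and $z\in\mathbb{Q}_{\le m}$ we have $\langle w,u\rangle\ge z\iff\langle w,v\rangle\ge z$ and $\langle w,u\rangle> z\iff\langle w,v\rangle> z$. **Theorem.** 1. There is a constant $K\in\mathbb{N}$ such that for all $t,m\in\mathbb{N}$ and every $c\in\mathbb{R}^t$ there is $c'\in\mathbb{Q}^t$ with $\|c'\|\le K\,((m+1)t)^K$ and $c\sim_m c'$. (For $m\ge1$ this bound is $(mt)^{O(1)}$, up to a constant factor.) 2. There is a constant $K\in\mathbb{N}$ such that for all $n,m\in\mathbb{N}$ and every PC $\alpha$ in $n$ variables there is a rational PC $\alpha'$ in $n$ variables with $[\![\alpha]\!]\cap(\mathbb{Q}_{\le m})^n=[\![\alpha']\!]\cap(\mathbb{Q}_{\le m})^n$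 that is of polynomial size, both in the sense that $$\mathrm{size}(\alpha')\le K\,(m+\mathrm{size}(\alpha)+1)^K$$ and, for sparsely written polynomials and independently of the coefficients of $\alpha$, in the sense that $$\mathrm{sparse}(\alpha')\le K\,(m+\deg\alpha+\mathrm{shape}(\alpha)+1)^K.$$ -/

import Mathlib

namespace RatPC

open scoped BigOperators

/-- Size of a rational `p / q` in lowest terms: `1 + ⌈log₂ (|p| + 1)⌉ + ⌈log₂ (|q| + 1)⌉`
(`Nat.clog 2` is the base-two logarithm rounded up). -/
def ratSize (a : ℚ) : ℕ :=
  1 + Nat.clog 2 (a.num.natAbs + 1) + Nat.clog 2 (a.den + 1)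

open Classical in
/-- Size of a real number: that of the rational if it is rational, and `1` if it is irrational. -/
noncomputable def realSize (x : ℝ) : ℕ :=
  if h : ∃ a : ℚ, (a : ℝ) = x then ratSize h.choose else 1

theorem realSize_ratCast (a : ℚ) : realSize (a : ℝ) = ratSize a := by
  have h : ∃ b : ℚ, (b : ℝ) = (a : ℝ) := ⟨a, rfl⟩
  have hc : h.choose = a := by exact_mod_cast h.choose_spec
  rw [realSize, dif_pos h, hc]

/-- Size of a rational vector. -/
def vecSize {t : ℕ} (v : Fin t → ℚ) : ℕ :=
  t + ∑ i, ratSize (v i)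

/-- The relation `u ∼ₘ v`: the vectors satisfy the same linear inequalities, strict and
non-strict, all of whose coefficients are rationals of size at most `m`. -/
def SameIneqs {t : ℕ} (m : ℕ) (u v : Fin t → ℝ) : Prop :=
  ∀ (w : Fin t → ℚ) (z : ℚ), (∀ i, ratSize (w i) ≤ m) → ratSize z ≤ m →
    (((z : ℝ) ≤ ∑ i, (w i : ℝ) * u i ↔ (z : ℝ) ≤ ∑ i, (w i : ℝ) * v i) ∧
     ((z : ℝ) < ∑ i, (w i : ℝ) * u i ↔ (z : ℝ) < ∑ i, (w i : ℝ) * v i))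

/-- Polynomial constraints in `n` variables: positive Boolean combinations of constraints
`p > 0` and `p ≥ 0` with real polynomials `p`. -/
inductive PC (n : ℕ) : Type
  | pos (p : MvPolynomial (Fin n) ℝ) : PC n
  | nonneg (p : MvPolynomial (Fin n) ℝ) : PC n
  | conj (k : ℕ) (β : Fin k → PC n) : PC n
  | disj (k : ℕ) (β : Fin k → PC n) : PC n

namespace PC

/-- The constraint accepts the rational point `x`. -/
def Accepts {n : ℕ} (x : Fin n → ℚ) : PC n → Prop
  | pos p => 0 < MvPolynomial.eval (fun i => (x i : ℝ)) p
  | nonneg p => 0 ≤ MvPolynomial.eval (fun i => (x i : ℝ)) p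
  | conj _ β => ∀ i, (β i).Accepts x
  | disj _ β => ∃ i, (β i).Accepts x

/-- The set `⟦α⟧` of accepted rational points. -/
def sem {n : ℕ} (α : PC n) : Set (Fin n → ℚ) :=
  {x | α.Accepts x}

/-- All polynomials that occur in the constraint have rational coefficients only. -/
def IsRational {n : ℕ} : PC n → Prop
  | pos p => ∀ r, ∃ a : ℚ, (a : ℝ) = p.coeff r
  | nonneg p => ∀ r, ∃ a : ℚ, (a : ℝ) = p.coeff r
  | conj _ β => ∀ i, (β i).IsRational
  | disj _ β => ∀ i, (β i).IsRational

/-- Size of a constraint, relative to a size `s` for the polynomials that occur in it. -/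
def sizeWith {n : ℕ} (s : MvPolynomial (Fin n) ℝ → ℕ) : PC n → ℕ
  | pos p => s p + 1
  | nonneg p => s p + 1
  | conj k β => k + ∑ i, (β i).sizeWith s
  | disj k β => k + ∑ i, (β i).sizeWith s

/-- The largest total degree of a polynomial that occurs in the constraint. -/
noncomputable def degree {n : ℕ} : PC n → ℕ
  | pos p => p.totalDegree
  | nonneg p => p.totalDegree
  | conj _ β => Finset.univ.sup fun i => (β i).degree
  | disj _ β => Finset.univ.sup fun i => (β i).degree

end PC

/-- Size of a polynomial, written as the sum of `c_r X^r` over all exponent vectors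
`r ∈ {0, …, k}ⁿ` with the least possible `k`: each `r` contributes
`size c_r + size r_1 + ⋯ + size r_n + n`, also when `c_r = 0`. -/
noncomputable def polySize {n : ℕ} (p : MvPolynomial (Fin n) ℝ) : ℕ :=
  ∑ r ∈ Fintype.piFinset
      (fun _ : Fin n => Finset.range (Finset.univ.sup (fun i => p.degreeOf i) + 1)),
    (realSize (p.coeff (Finsupp.equivFunOnFinite.symm r)) + ∑ i, ratSize (r i : ℚ) + n)

/-- Sparse size of a polynomial: only monomials that occur in it contribute. -/
noncomputable def polySparseSize {n : ℕ} (p : MvPolynomial (Fin n) ℝ) : ℕ :=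
  ∑ r ∈ p.support, (realSize (p.coeff r) + ∑ i, ratSize (r i : ℚ) + n)

/-- Sparse size of a polynomial with every nonzero coefficient counted as `1`. -/
noncomputable def polyShapeSize {n : ℕ} (p : MvPolynomial (Fin n) ℝ) : ℕ :=
  ∑ r ∈ p.support, (1 + ∑ i, ratSize (r i : ℚ) + n)

namespace PC

/-- Size of a constraint. -/
noncomputable def size {n : ℕ} (α : PC n) : ℕ := α.sizeWith polySize

/-- Size of a constraint with sparsely written polynomials. -/
noncomputable def sparseSize {n : ℕ} (α : PC n) : ℕ := α.sizeWith polySparseSize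

/-- Sparse size of a constraint with every nonzero coefficient counted as `1`. -/
noncomputable def shapeSize {n : ℕ} (α : PC n) : ℕ := α.sizeWith polyShapeSize

end PC

/-- The set `ℚⁿ_{≤ m}` of the rational points all of whose coordinates have size at most `m`. -/
def boundedPoints (n m : ℕ) : Set (Fin n → ℚ) :=
  {x | ∀ i, ratSize (x i) ≤ m}

end RatPC

namespace RatPC

open scoped Matrix

/-! Both parts rest on `exists_int_vector_same_signs`. The integer vectors in a box whose scalar
product with the given real vector `y` is nonnegative define a system of inequalities `⟨a, x⟩ ≥ 0`,
sharpened to `⟨a, x⟩ ≥ 1` where the product is positive. A large multiple of `y` solves it, so it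
has a vertex. By Cramer's rule the vertex is an integer vector divided by a determinant with entries
in the box, so clearing that one denominator gives integers with polynomially many bits, however
many inequalities there are.

For linear inequalities this is applied to the homogenised vector `(1, c)`, followed by division by
the first coordinate. For constraints it is applied to the coefficient vector of each polynomial
separately: at a rational point of bounded size, the monomial values times a positive common
denominator are integers of bounded bit length. The support does not grow, so only coefficient sizes
have to be estimated. -/

/-! ### Vertices of polyhedra and small integer solutions -/

/-- A polyhedron `{x | b k ≤ ⟨a k, x⟩}` without lines has a point at which
the tight constraints determine every direction. -/
theorem exists_point_tight_constraints {κ ι : Type*} [Fintype κ] [Fintype ι]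
    (a : κ → ι → ℝ) (b : κ → ℝ) (hfeas : ∃ x : ι → ℝ, ∀ k, b k ≤ a k ⬝ᵥ x)
    (hline : ∀ d : ι → ℝ, (∀ k, a k ⬝ᵥ d = 0) → d = 0) :
    ∃ x : ι → ℝ, (∀ k, b k ≤ a k ⬝ᵥ x) ∧
      ∀ d : ι → ℝ, (∀ k, a k ⬝ᵥ x = b k → a k ⬝ᵥ d = 0) → d = 0 := by
  classical
  let tight : (ι → ℝ) → Finset κ := fun x => Finset.univ.filter fun k => a k ⬝ᵥ x = b k
  -- Take a feasible point with the most tight constraints. Moving along a direction that keeps them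
  -- tight, until another constraint becomes tight, would contradict maximality.
  obtain ⟨J, ⟨x, hx, hJ⟩, hmax⟩ := Set.Finite.exists_maximalFor Finset.card
    {J : Finset κ | ∃ x : ι → ℝ, (∀ k, b k ≤ a k ⬝ᵥ x) ∧ tight x = J} (Set.toFinite _)
    (let ⟨x, hx⟩ := hfeas; ⟨tight x, x, hx, rfl⟩)
  refine ⟨x, hx, fun d hd => ?_⟩
  by_contra hd0
  obtain ⟨e, he, k₀, hk₀⟩ : ∃ e : ι → ℝ, (∀ k, a k ⬝ᵥ x = b k → a k ⬝ᵥ e = 0) ∧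
      ∃ k, a k ⬝ᵥ e < 0 := by
    obtain ⟨k, hk⟩ : ∃ k, a k ⬝ᵥ d ≠ 0 := by
      by_contra! h
      exact hd0 (hline d h)
    rcases lt_or_gt_of_ne hk with h | h
    · exact ⟨d, hd, k, h⟩
    · exact ⟨-d, fun k hk => by simp [hd k hk], k, by simpa using h⟩
  obtain ⟨k, hk, hmin⟩ := Finset.exists_min_image
    (Finset.univ.filter fun k => a k ⬝ᵥ e < 0)
    (fun k => (a k ⬝ᵥ x - b k) / (-(a k ⬝ᵥ e))) ⟨k₀, by simpa using hk₀⟩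
  simp only [Finset.mem_filter, Finset.mem_univ, true_and] at hk hmin
  -- The largest step along `e` that stays feasible; constraint `k` is the first to become tight.
  set τ := (a k ⬝ᵥ x - b k) / (-(a k ⬝ᵥ e)) with hτ
  have hτ0 : 0 ≤ τ := div_nonneg (by linarith [hx k]) (by linarith)
  have hval : ∀ j, a j ⬝ᵥ (x + τ • e) = a j ⬝ᵥ x + τ * (a j ⬝ᵥ e) := fun j => by
    rw [dotProduct_add, dotProduct_smul, smul_eq_mul]
  have hktight : a k ⬝ᵥ (x + τ • e) = b k := by
    rw [hval, hτ]
    field_simp [hk.ne]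
    ring
  have hfeas' : ∀ j, b j ≤ a j ⬝ᵥ (x + τ • e) := fun j => by
    rw [hval]
    rcases lt_or_ge (a j ⬝ᵥ e) 0 with h | h
    · have := hmin j h
      rw [le_div_iff₀ (by linarith)] at this
      linarith
    · have := mul_nonneg hτ0 h
      linarith [hx j]
  have hlt : J ⊂ tight (x + τ • e) := by
    rw [← hJ]
    refine Finset.ssubset_iff_of_subset (fun j hj => ?_) |>.2 ⟨k, by simpa [tight] using hktight, ?_⟩
    · simp only [tight, Finset.mem_filter, Finset.mem_univ, true_and] at hj ⊢
      rw [hval, he j hj, hj, mul_zero, add_zero]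
    · simp only [tight, Finset.mem_filter, Finset.mem_univ, true_and]
      exact fun h => hk.ne (he k h)
  have := hmax ⟨_, hfeas', rfl⟩ (Finset.card_le_card hlt.subset)
  exact absurd (Finset.card_lt_card hlt) (not_lt.2 this)

/-- Vectors that are jointly orthogonal to nothing but `0` contain a basis. -/
theorem exists_square_submatrix {κ ι : Type*} [Fintype ι] [DecidableEq ι]
    (a : κ → ι → ℝ) (J : Set κ) (h : ∀ d : ι → ℝ, (∀ k ∈ J, a k ⬝ᵥ d = 0) → d = 0) :
    ∃ f : ι → κ, (∀ i, f i ∈ J) ∧ (Matrix.of fun i => a (f i)).det ≠ 0 := by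
  have hspan : Submodule.span ℝ (a '' J) = ⊤ := by
    -- A proper span lies in the kernel of a nonzero functional, whose coordinate vector is then
    -- orthogonal to all of `J`.
    by_contra hne
    obtain ⟨φ, hφ, hle⟩ := Submodule.exists_le_ker_of_lt_top _ (lt_top_iff_ne_top.2 hne)
    have key : ∀ v : ι → ℝ, φ v = v ⬝ᵥ fun i => φ (Pi.single i 1) := fun v => by
      conv_lhs => rw [pi_eq_sum_univ' v]
      simp [dotProduct]
    have h0 := h (fun i => φ (Pi.single i 1)) fun k hk => by
      rw [← key]
      exact hle (Submodule.subset_span ⟨k, hk, rfl⟩)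
    refine hφ (LinearMap.ext fun v => ?_)
    rw [key, h0]
    simp
  obtain ⟨s, hs, hspan', hli⟩ := exists_linearIndependent ℝ (a '' J)
  rw [hspan] at hspan'
  let B : Module.Basis s ℝ (ι → ℝ) := Module.Basis.mk hli (by simp [hspan'])
  let e : ι ≃ s := (Pi.basisFun ℝ ι).indexEquiv B
  choose f hfJ hf using fun i => hs (e i).2
  refine ⟨f, hfJ, ?_⟩
  have hrows : (Matrix.of fun i => a (f i)) = fun i => ((e i : s) : ι → ℝ) :=
    funext fun i => hf i
  have hu : IsUnit (Matrix.of fun i => a (f i)) := by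
    rw [← Matrix.linearIndependent_rows_iff_isUnit, hrows]
    exact hli.comp e e.injective
  exact ((Matrix.isUnit_iff_isUnit_det _).1 hu).ne_zero

/-- Every real vector can be replaced by a small integer vector without changing the sign of
its scalar product with any integer vector whose entries are bounded by `B`. -/
theorem exists_int_vector_same_signs {ι : Type*} [Fintype ι] (B : ℕ) (hB : 1 ≤ B) (y : ι → ℝ) :
    ∃ x : ι → ℤ, (∀ j, |x j| ≤ (Fintype.card ι).factorial * (B : ℤ) ^ Fintype.card ι) ∧
      ∀ a : ι → ℤ, (∀ j, |a j| ≤ B) →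
        ((0 ≤ ∑ j, (a j : ℝ) * y j ↔ 0 ≤ ∑ j, a j * x j) ∧
         (0 < ∑ j, (a j : ℝ) * y j ↔ 0 < ∑ j, a j * x j)) := by
  classical
  let κ := {a : ι → ℤ // (∀ j, |a j| ≤ B) ∧ 0 ≤ ∑ j, (a j : ℝ) * y j}
  have : Finite κ := by
    refine Set.Finite.subset (Set.finite_Icc (fun _ : ι => -(B : ℤ)) fun _ => (B : ℤ)) ?_
    exact fun a ha => ⟨fun j => (abs_le.1 (ha.1 j)).1, fun j => (abs_le.1 (ha.1 j)).2⟩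
  have : Fintype κ := Fintype.ofFinite κ
  let A : κ → ι → ℝ := fun a j => a.1 j
  -- Asking for `≥ 1` in place of `> 0` keeps the system closed, and loses nothing since `y` may be
  -- rescaled.
  let b : κ → ℤ := fun a => if 0 < ∑ j, (a.1 j : ℝ) * y j then 1 else 0
  have hfeas : ∃ x : ι → ℝ, ∀ k, (b k : ℝ) ≤ A k ⬝ᵥ x := by
    -- A scaling factor above the inverse of every positive value `A k ⬝ᵥ y`.
    let L : ℝ := ∑ k : κ, |(A k ⬝ᵥ y)⁻¹|
    refine ⟨L • y, fun k => ?_⟩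
    have hk : 0 ≤ A k ⬝ᵥ y := k.2.2
    rw [dotProduct_smul, smul_eq_mul]
    by_cases h : 0 < A k ⬝ᵥ y
    · have : (b k : ℝ) = 1 := by
        have : b k = 1 := if_pos h
        rw [this]; simp
      rw [this, ← inv_mul_cancel₀ h.ne']
      refine mul_le_mul_of_nonneg_right (le_trans (le_abs_self _) ?_) hk
      exact Finset.single_le_sum (f := fun k : κ => |(A k ⬝ᵥ y)⁻¹|)
        (fun _ _ => abs_nonneg _) (Finset.mem_univ k)
    · have : (b k : ℝ) = 0 := by
        have : b k = 0 := if_neg h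
        rw [this]; simp
      rw [this]
      exact mul_nonneg (Finset.sum_nonneg fun _ _ => abs_nonneg _) hk
  -- For each `i`, one of the two signed unit vectors belongs to the system.
  have hline : ∀ d : ι → ℝ, (∀ k, A k ⬝ᵥ d = 0) → d = 0 := by
    intro d hd
    funext i
    have hsingle : ∀ (s : ℤ) (u : ι → ℝ),
        ∑ j, ((Pi.single i s : ι → ℤ) j : ℝ) * u j = s * u i := fun s u => by
      rw [Finset.sum_eq_single i] <;> simp +contextual
    have hbox : ∀ s : ℤ, |s| ≤ 1 → ∀ j, |(Pi.single i s : ι → ℤ) j| ≤ B := fun s hs j => by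
      by_cases hj : j = i
      · subst hj
        simp only [Pi.single_eq_same]
        exact hs.trans (by exact_mod_cast hB)
      · simp [hj]
    rcases le_total 0 (y i) with h | h
    · have := hd ⟨Pi.single i 1, hbox 1 (by simp), by rw [hsingle]; simpa using h⟩
      have h2 := hsingle 1 d
      simp only [A, dotProduct] at this
      rw [h2] at this
      simpa using this
    · have := hd ⟨Pi.single i (-1), hbox (-1) (by simp), by rw [hsingle]; simpa using h⟩
      have h2 := hsingle (-1) d
      simp only [A, dotProduct] at this
      rw [h2] at this
      simpa using this
  obtain ⟨v, hv, hvt⟩ := exists_point_tight_constraints A (fun k => (b k : ℝ)) hfeas hline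
  obtain ⟨f, hf, hdet⟩ := exists_square_submatrix A {k | A k ⬝ᵥ v = b k} hvt
  let M : Matrix ι ι ℤ := Matrix.of fun i => (f i).1
  have hM : (Matrix.of fun i => A (f i)) = M.map (Int.castRingHom ℝ) := rfl
  have hMdet : (Matrix.of fun i => A (f i)).det = (M.det : ℝ) := by
    rw [hM, ← RingHom.mapMatrix_apply, ← RingHom.map_det]; rfl
  have hD : M.det ≠ 0 := fun h => hdet (by rw [hMdet, h]; simp)
  have hcr : ∀ j, (M.det : ℝ) * v j = ((M.cramer fun i => b (f i)) j : ℤ) := fun j => by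
    have hmv : (M.map (Int.castRingHom ℝ)) *ᵥ v = fun i => (b (f i) : ℝ) := funext fun i => hf i
    have h1 : (M.map (Int.castRingHom ℝ)).adjugate *ᵥ ((M.map (Int.castRingHom ℝ)) *ᵥ v)
        = (M.det : ℝ) • v := by
      rw [Matrix.mulVec_mulVec, Matrix.adjugate_mul, Matrix.smul_mulVec, Matrix.one_mulVec,
        ← hMdet, hM]
    rw [hmv, ← Matrix.cramer_eq_adjugate_mulVec] at h1
    have h2 := congrFun h1 j
    rw [Pi.smul_apply, smul_eq_mul, Matrix.cramer_apply] at h2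
    rw [← h2, Matrix.cramer_apply, ← eq_intCast (Int.castRingHom ℝ), RingHom.map_det,
      RingHom.mapMatrix_apply, Matrix.map_updateCol]
    rfl
  -- This is `|det M| • v`; the sign factor makes the scaling positive, so that it preserves
  -- inequalities.
  let x : ι → ℤ := fun j => M.det.sign * (M.cramer fun i => b (f i)) j
  have hx : ∀ j, (x j : ℝ) = |(M.det : ℝ)| * v j := fun j => by
    have h1 : ((M.det.sign * M.det : ℤ) : ℝ) = |(M.det : ℝ)| := by
      rw [Int.sign_mul_self_eq_abs]; simp
    rw [← h1]
    simp only [x]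
    rw [Int.cast_mul, Int.cast_mul, ← hcr j]
    ring
  have hDpos : 0 < |(M.det : ℝ)| := abs_pos.2 (by exact_mod_cast hD)
  have hsum : ∀ a : ι → ℤ, ((∑ j, a j * x j : ℤ) : ℝ)
      = |(M.det : ℝ)| * ∑ j, (a j : ℝ) * v j := fun a => by
    rw [Int.cast_sum, Finset.mul_sum]
    exact Finset.sum_congr rfl fun j _ => by rw [Int.cast_mul, hx]; ring
  have hnn : ∀ a : ι → ℤ, (∀ j, |a j| ≤ B) → 0 ≤ ∑ j, (a j : ℝ) * y j → 0 ≤ ∑ j, a j * x j := by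
    intro a ha h
    have h1 : (b ⟨a, ha, h⟩ : ℝ) ≤ ∑ j, (a j : ℝ) * v j := hv ⟨a, ha, h⟩
    have h0 : (0 : ℝ) ≤ b ⟨a, ha, h⟩ := by
      have : 0 ≤ b ⟨a, ha, h⟩ := by simp only [b]; split_ifs <;> simp
      exact_mod_cast this
    have := mul_nonneg hDpos.le (h0.trans h1)
    rw [← hsum] at this
    exact_mod_cast this
  have hpos : ∀ a : ι → ℤ, (∀ j, |a j| ≤ B) → 0 < ∑ j, (a j : ℝ) * y j → 0 < ∑ j, a j * x j := by
    intro a ha h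
    have h1 : (b ⟨a, ha, h.le⟩ : ℝ) ≤ ∑ j, (a j : ℝ) * v j := hv ⟨a, ha, h.le⟩
    have h0 : b ⟨a, ha, h.le⟩ = 1 := if_pos h
    rw [h0, Int.cast_one] at h1
    have := mul_pos hDpos (one_pos.trans_le h1)
    rw [← hsum] at this
    exact_mod_cast this
  -- The box is symmetric, so the converse implications follow by passing to `-a`.
  have hneg : ∀ a : ι → ℤ, (∀ j, |a j| ≤ B) → ∀ j, |(-a) j| ≤ B := fun a ha j => by
    simpa using ha j
  refine ⟨x, fun j => ?_, fun a ha => ⟨⟨hnn a ha, fun h => ?_⟩, ⟨hpos a ha, fun h => ?_⟩⟩⟩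
  · have h1 : |x j| = |(M.cramer fun i => b (f i)) j| := by
      simp only [x]
      rw [abs_mul, Int.abs_sign_of_ne_zero hD, one_mul]
    rw [h1, Matrix.cramer_apply]
    have := Matrix.det_le (A := M.updateCol j fun i => b (f i)) (abv := AbsoluteValue.abs)
      (x := (B : ℤ)) fun i k => ?_
    · simpa [nsmul_eq_mul] using this
    · simp only [AbsoluteValue.abs_apply, Matrix.updateCol_apply]
      split_ifs
      · have : |b (f i)| ≤ 1 := by simp only [b]; split_ifs <;> simp
        exact this.trans (by exact_mod_cast hB)
      · exact (f i).2.1 k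
  · by_contra! hlt
    have := hpos (-a) (hneg a ha) (by simpa using hlt)
    simp at this
    omega
  · by_contra! hle
    have := hnn (-a) (hneg a ha) (by simpa using hle)
    simp at this
    omega

/-! ### Sizes of rationals and common denominators -/

theorem natAbs_num_le_of_ratSize_le {a : ℚ} {m : ℕ} (h : ratSize a ≤ m) :
    a.num.natAbs ≤ 2 ^ m := by
  have h1 := Nat.le_pow_clog (b := 2) (by norm_num) (a.num.natAbs + 1)
  have h2 : 2 ^ Nat.clog 2 (a.num.natAbs + 1) ≤ 2 ^ m :=
    Nat.pow_le_pow_right (by norm_num) (by unfold ratSize at h; omega)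
  omega

theorem den_le_of_ratSize_le {a : ℚ} {m : ℕ} (h : ratSize a ≤ m) : a.den ≤ 2 ^ m := by
  have h1 := Nat.le_pow_clog (b := 2) (by norm_num) (a.den + 1)
  have h2 : 2 ^ Nat.clog 2 (a.den + 1) ≤ 2 ^ m :=
    Nat.pow_le_pow_right (by norm_num) (by unfold ratSize at h; omega)
  omega

theorem clog_succ_le {k e : ℕ} (h : k ≤ 2 ^ e) : Nat.clog 2 (k + 1) ≤ e + 1 := by
  refine Nat.clog_le_of_le_pow ?_
  have := Nat.one_le_two_pow (n := e)
  rw [pow_succ]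
  omega

theorem ratSize_intCast_le {a : ℤ} {e : ℕ} (h : a.natAbs ≤ 2 ^ e) : ratSize (a : ℚ) ≤ e + 3 := by
  have := clog_succ_le h
  have h2 := clog_succ_le (k := 1) (e := 0) le_rfl
  simp only [ratSize, Rat.num_intCast, Rat.den_intCast]
  omega

theorem ratSize_div_le {a b : ℤ} {e : ℕ} (hb : b ≠ 0) (ha : a.natAbs ≤ 2 ^ e)
    (hbe : b.natAbs ≤ 2 ^ e) : ratSize ((a : ℚ) / b) ≤ 2 * e + 3 := by
  have hden : ((a : ℚ) / b).den ≤ 2 ^ e := by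
    refine le_trans (Nat.le_of_dvd (Int.natAbs_pos.2 hb) ?_) hbe
    rw [← Int.natCast_dvd, ← Rat.divInt_eq_div]
    exact Rat.den_dvd a b
  have hnum : ((a : ℚ) / b).num.natAbs ≤ 2 ^ e := by
    by_cases ha0 : a = 0
    · simp [ha0]
    refine le_trans (Nat.le_of_dvd (Int.natAbs_pos.2 ha0) ?_) ha
    rw [Int.natAbs_dvd_natAbs, ← Rat.divInt_eq_div]
    exact Rat.num_dvd a hb
  have h1 := clog_succ_le hden
  have h2 := clog_succ_le hnum
  unfold ratSize
  omega

theorem ratSize_neg (a : ℚ) : ratSize (-a) = ratSize a := by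
  simp [ratSize]

/-- Clearing the denominators of finitely many rationals of bounded size. -/
theorem exists_common_denominator {ι : Type*} [Fintype ι] (m : ℕ) (q : ι → ℚ)
    (hq : ∀ i, ratSize (q i) ≤ m) :
    ∃ (d : ℕ) (a : ι → ℤ), 0 < d ∧ (∀ i, (a i : ℚ) = d * q i) ∧
      ∀ i, |a i| ≤ ((2 ^ (m * Fintype.card ι) : ℕ) : ℤ) := by
  classical
  refine ⟨∏ i, (q i).den, fun i => (q i).num * ∏ j ∈ Finset.univ.erase i, ((q j).den : ℤ),
    Finset.prod_pos fun i _ => (q i).den_pos, fun i => ?_, fun i => ?_⟩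
  · rw [← Finset.mul_prod_erase _ _ (Finset.mem_univ i)]
    push_cast
    have h := Rat.mul_den_eq_num (q i)
    rw [← h]
    ring
  -- One numerator and `card ι - 1` denominators, each at most `2 ^ m`, make up the entry.
  · have h1 : ∏ j ∈ Finset.univ.erase i, (q j).den ≤ (2 ^ m) ^ (Fintype.card ι - 1) := by
      refine (Finset.prod_le_pow_card _ _ _ fun j _ => den_le_of_ratSize_le (hq j)).trans ?_
      rw [Finset.card_erase_of_mem (Finset.mem_univ i), Finset.card_univ]
    have h2 : 0 < Fintype.card ι := Fintype.card_pos_iff.2 ⟨i⟩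
    have h3 := Nat.mul_le_mul (natAbs_num_le_of_ratSize_le (hq i)) h1
    rw [← pow_succ', Nat.sub_add_cancel h2, ← pow_mul] at h3
    simp only
    rw [← Nat.cast_prod, Int.abs_eq_natAbs, Int.natAbs_mul, Int.natAbs_natCast]
    exact_mod_cast h3

theorem factorial_mul_pow_le (N e : ℕ) : N.factorial * (2 ^ e) ^ N ≤ 2 ^ (N * N + e * N) := by
  rw [pow_add, ← pow_mul]
  refine Nat.mul_le_mul_right _ (N.factorial_le_pow.trans ?_)
  rw [pow_mul]
  exact Nat.pow_le_pow_left Nat.lt_two_pow_self.le N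

/-- `exists_int_vector_same_signs` for a box of size a power of two. -/
theorem exists_int_vector_same_signs_two_pow {ι : Type*} [Fintype ι] (e : ℕ) (y : ι → ℝ) :
    ∃ x : ι → ℤ,
      (∀ j, (x j).natAbs ≤ 2 ^ (Fintype.card ι * Fintype.card ι + e * Fintype.card ι)) ∧
      ∀ a : ι → ℤ, (∀ j, |a j| ≤ ((2 ^ e : ℕ) : ℤ)) →
        ((0 ≤ ∑ j, (a j : ℝ) * y j ↔ 0 ≤ ∑ j, a j * x j) ∧
         (0 < ∑ j, (a j : ℝ) * y j ↔ 0 < ∑ j, a j * x j)) := by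
  obtain ⟨x, hx, h⟩ := exists_int_vector_same_signs (2 ^ e) Nat.one_le_two_pow y
  refine ⟨x, fun j => le_trans ?_ (factorial_mul_pow_le _ e), h⟩
  have := hx j
  rw [Int.abs_eq_natAbs] at this
  exact_mod_cast this

/-! ### Linear inequalities -/

theorem exists_rat_vector_sameIneqs (t m : ℕ) (c : Fin t → ℝ) : ∃ c' : Fin t → ℚ,
    vecSize c' ≤ 13 * ((m + 1) * t) ^ 13 ∧ SameIneqs m c (fun i => (c' i : ℝ)) := by
  let y : Option (Fin t) → ℝ := fun o => o.elim 1 c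
  obtain ⟨x, hxb, hx⟩ := exists_int_vector_same_signs_two_pow (m * (t + 1)) y
  simp only [Fintype.card_option, Fintype.card_fin] at hxb
  set e := (t + 1) * (t + 1) + m * (t + 1) * (t + 1) with he
  -- The unit vector at `none` tests the sign of the homogenising coordinate, which is `1` in `y`.
  have hx0 : 0 < x none := by
    have h := (hx (fun o => o.elim 1 0) ?_).2
    · simpa [Fintype.sum_option, y] using h
    · rintro (_ | i)
      · simp only [Option.elim, abs_one]
        exact_mod_cast Nat.one_le_two_pow (n := m * (t + 1))
      · simp
  refine ⟨fun i => (x (some i) : ℚ) / x none, ?_, ?_⟩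
  · have h1 : vecSize (fun i => (x (some i) : ℚ) / x none) ≤ t + t * (2 * e + 3) := by
      refine Nat.add_le_add_left ((Finset.sum_le_card_nsmul _ _ (2 * e + 3) fun i _ =>
        ratSize_div_le hx0.ne' (hxb _) (hxb _)).trans ?_) t
      simp
    refine h1.trans ?_
    rcases Nat.eq_zero_or_pos t with rfl | ht
    · simp
    -- The true bound is cubic; exponent `13` only serves to share one constant with the factor.
    have h2 : t + t * (2 * e + 3) ≤ 12 * ((m + 1) * t) ^ 3 := by
      have h3 : (t + 1) * (t + 1) ≤ (2 * t) * (2 * t) := Nat.mul_le_mul (by omega) (by omega)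
      have h4 : e ≤ 4 * ((m + 1) * (t * t)) := by
        have : e = (m + 1) * ((t + 1) * (t + 1)) := by rw [he]; ring
        rw [this]
        calc _ ≤ (m + 1) * ((2 * t) * (2 * t)) := Nat.mul_le_mul_left _ h3
          _ = _ := by ring
      have h5 : 1 ≤ (m + 1) * (t * t) := Nat.mul_pos (by omega) (Nat.mul_pos ht ht)
      calc t + t * (2 * e + 3) = t * (2 * e + 4) := by ring
        _ ≤ t * (12 * ((m + 1) * (t * t))) := Nat.mul_le_mul_left _ (by omega)
        _ = 12 * ((m + 1) ^ 1 * t ^ 3) := by ring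
        _ ≤ 12 * ((m + 1) ^ 3 * t ^ 3) := by gcongr <;> omega
        _ = _ := by rw [mul_pow]
    have h6 : 1 ≤ (m + 1) * t := Nat.mul_pos (by omega) ht
    exact h2.trans (Nat.mul_le_mul (by norm_num) (Nat.pow_le_pow_right h6 (by norm_num)))
  · intro w z hw hz
    obtain ⟨d, a, hd, ha, hab⟩ := exists_common_denominator m
      (fun o : Option (Fin t) => o.elim (-z) w) (by
        rintro (_ | i)
        · simpa [ratSize_neg] using hz
        · exact hw i)
    simp only [Fintype.card_option, Fintype.card_fin] at hab
    have haR : ∀ o : Option (Fin t), (a o : ℝ) = d * ((o.elim (-z) w : ℚ) : ℝ) := fun o => by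
      exact_mod_cast ha o
    have hdR : (0 : ℝ) < d := by exact_mod_cast hd
    have hx0R : (0 : ℝ) < x none := by exact_mod_cast hx0
    have hy : ∑ o, (a o : ℝ) * y o = d * (∑ i, (w i : ℝ) * c i - z) := by
      rw [Fintype.sum_option, mul_sub, Finset.mul_sum]
      simp only [haR, y, Option.elim]
      push_cast
      simp only [mul_assoc]
      ring
    have hxs : ((∑ o, a o * x o : ℤ) : ℝ)
        = d * x none * (∑ i, (w i : ℝ) * (((x (some i) : ℚ) / x none : ℚ) : ℝ) - z) := by
      have h1 : ∀ i, (d : ℝ) * x none * ((w i : ℝ) * (((x (some i) : ℚ) / x none : ℚ) : ℝ))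
          = d * w i * x (some i) := fun i => by
        push_cast
        field_simp
      rw [Int.cast_sum, Fintype.sum_option, mul_sub, Finset.mul_sum]
      simp only [h1, Int.cast_mul, haR, Option.elim]
      push_cast
      ring
    obtain ⟨h1, h2⟩ := hx a hab
    rw [hy, ← Int.cast_nonneg_iff (R := ℝ), hxs, mul_nonneg_iff_of_pos_left hdR,
      mul_nonneg_iff_of_pos_left (mul_pos hdR hx0R), sub_nonneg, sub_nonneg] at h1
    rw [hy, ← Int.cast_pos (R := ℝ), hxs, mul_pos_iff_of_pos_left hdR,
      mul_pos_iff_of_pos_left (mul_pos hdR hx0R), sub_pos, sub_pos] at h2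
    exact ⟨h1, h2⟩

/-! ### Polynomials and their sizes -/

/-- Replacing the coefficients of a polynomial by small integers, without changing its sign
at rational points of bounded size. -/
theorem exists_int_polynomial_same_signs {n : ℕ} (m : ℕ) (p : MvPolynomial (Fin n) ℝ) :
    ∃ p' : MvPolynomial (Fin n) ℝ, (∀ r, ∃ a : ℚ, (a : ℝ) = p'.coeff r) ∧
      p'.support ⊆ p.support ∧
      (∀ r, realSize (p'.coeff r) ≤
        p.support.card * p.support.card + m * n * p.totalDegree * p.support.card + 3) ∧
      ∀ x ∈ boundedPoints n m,
        ((0 ≤ MvPolynomial.eval (fun i => (x i : ℝ)) p ↔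
          0 ≤ MvPolynomial.eval (fun i => (x i : ℝ)) p') ∧
         (0 < MvPolynomial.eval (fun i => (x i : ℝ)) p ↔
          0 < MvPolynomial.eval (fun i => (x i : ℝ)) p')) := by
  classical
  obtain ⟨c, hcb, hc⟩ := exists_int_vector_same_signs_two_pow (ι := p.support)
    (m * n * p.totalDegree) (fun r => p.coeff r)
  rw [Fintype.card_coe] at hcb
  let p' : MvPolynomial (Fin n) ℝ := ∑ r : p.support, MvPolynomial.monomial r.1 (c r : ℝ)
  have hcoeff : ∀ r, p'.coeff r = if h : r ∈ p.support then ((c ⟨r, h⟩ : ℤ) : ℝ) else 0 := by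
    intro r
    simp only [p', MvPolynomial.coeff_sum, MvPolynomial.coeff_monomial]
    split_ifs with h
    · rw [Finset.sum_eq_single (⟨r, h⟩ : p.support)]
      · simp
      · intro s _ hs
        exact if_neg fun h' => hs (Subtype.ext h')
      · simp
    · exact Finset.sum_eq_zero fun s _ => if_neg fun h' => h (by rw [← h']; exact s.2)
  refine ⟨p', fun r => ?_, fun r hr => ?_, fun r => ?_, fun x hx => ?_⟩
  · rw [hcoeff]
    split_ifs with h
    · exact ⟨(c ⟨r, h⟩ : ℚ), by simp⟩
    · exact ⟨0, by simp⟩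
  · by_contra h
    rw [MvPolynomial.mem_support_iff, hcoeff, dif_neg h] at hr
    exact hr rfl
  · rw [hcoeff]
    split_ifs with h
    · have := ratSize_intCast_le (hcb ⟨r, h⟩)
      rw [← realSize_ratCast] at this
      simpa using this
    · have := ratSize_intCast_le (a := 0) (e := 0) (by simp)
      rw [← realSize_ratCast] at this
      simp only [Int.cast_zero, Rat.cast_zero] at this
      omega
  · set D := p.totalDegree with hD
    -- The monomial values at `x`, multiplied by the common denominator `Q` below. Each variable
    -- contributes `D` factors of at most `2 ^ m`.
    let a : p.support → ℤ := fun r =>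
      ∏ i, (x i).num ^ r.1 i * ((x i).den : ℤ) ^ (D - r.1 i)
    have hle : ∀ r : p.support, ∀ i, r.1 i ≤ D := fun r i =>
      (MvPolynomial.le_degreeOf_of_mem_support i r.2).trans (MvPolynomial.degreeOf_le_totalDegree p i)
    have hab : ∀ r, |a r| ≤ ((2 ^ (m * n * D) : ℕ) : ℤ) := fun r => by
      have h1 : (a r).natAbs ≤ 2 ^ (m * n * D) := by
        have h2 : (a r).natAbs
            = ∏ i, (x i).num.natAbs ^ r.1 i * (x i).den ^ (D - r.1 i) := by
          simp only [a]
          rw [← Int.natAbsHom_apply, map_prod]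
          simp [Int.natAbs_mul, Int.natAbs_pow]
        rw [h2]
        refine (Finset.prod_le_pow_card _ _ ((2 ^ m) ^ D) fun i _ => ?_).trans ?_
        · calc _ ≤ (2 ^ m) ^ r.1 i * (2 ^ m) ^ (D - r.1 i) :=
              Nat.mul_le_mul (Nat.pow_le_pow_left (natAbs_num_le_of_ratSize_le (hx i)) _)
                (Nat.pow_le_pow_left (den_le_of_ratSize_le (hx i)) _)
            _ = (2 ^ m) ^ D := by rw [← pow_add, Nat.add_sub_cancel' (hle r i)]
        · rw [Finset.card_univ, Fintype.card_fin, ← pow_mul, ← pow_mul]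
          exact le_of_eq (by ring)
      rw [Int.abs_eq_natAbs]
      exact_mod_cast h1
    let Q : ℝ := ∏ i, ((x i).den : ℝ) ^ D
    have hQ : 0 < Q := Finset.prod_pos fun i _ => pow_pos (by exact_mod_cast (x i).den_pos) _
    have haQ : ∀ r : p.support, (a r : ℝ) = Q * ∏ i, (x i : ℝ) ^ r.1 i := fun r => by
      simp only [a, Q]
      rw [← Finset.prod_mul_distrib, Int.cast_prod]
      refine Finset.prod_congr rfl fun i _ => ?_
      have h3 : ((x i).num : ℝ) = x i * (x i).den := by
        exact_mod_cast (Rat.mul_den_eq_num (x i)).symm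
      push_cast
      rw [h3, mul_pow, mul_assoc, ← pow_add, Nat.add_sub_cancel' (hle r i), mul_comm]
    have hp : ∑ r, (a r : ℝ) * p.coeff r = Q * MvPolynomial.eval (fun i => (x i : ℝ)) p := by
      rw [MvPolynomial.eval_eq', Finset.mul_sum, ← Finset.sum_coe_sort p.support]
      exact Finset.sum_congr rfl fun r _ => by rw [haQ]; ring
    have hp' : ((∑ r, a r * c r : ℤ) : ℝ)
        = Q * MvPolynomial.eval (fun i => (x i : ℝ)) p' := by
      simp only [p', map_sum, MvPolynomial.eval_monomial, Int.cast_sum, Finset.mul_sum]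
      refine Finset.sum_congr rfl fun r _ => ?_
      rw [Int.cast_mul, haQ, Finsupp.prod_fintype _ _ (by simp)]
      ring
    obtain ⟨h1, h2⟩ := hc a hab
    rw [hp, ← Int.cast_nonneg_iff (R := ℝ), hp', mul_nonneg_iff_of_pos_left hQ,
      mul_nonneg_iff_of_pos_left hQ] at h1
    rw [hp, ← Int.cast_pos (R := ℝ), hp', mul_pos_iff_of_pos_left hQ,
      mul_pos_iff_of_pos_left hQ] at h2
    exact ⟨h1, h2⟩

theorem one_le_realSize (x : ℝ) : 1 ≤ realSize x := by
  unfold realSize ratSize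
  split_ifs <;> omega

theorem polySparseSize_le {n C : ℕ} {p p' : MvPolynomial (Fin n) ℝ} (hC : 1 ≤ C)
    (hsupp : p'.support ⊆ p.support) (hcoeff : ∀ r, realSize (p'.coeff r) ≤ C) :
    polySparseSize p' ≤ C * polyShapeSize p := by
  refine (Finset.sum_le_sum_of_subset hsupp).trans ?_
  rw [polyShapeSize, Finset.mul_sum]
  refine Finset.sum_le_sum fun r _ => ?_
  have := hcoeff r
  nlinarith [Nat.zero_le (∑ i, ratSize (r i : ℚ) + n)]

/-- The exponent grid can only shrink with the support. Grid points where `p` has coefficient `0`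
are covered because every real has size at least `1`. -/
theorem polySize_le {n C : ℕ} {p p' : MvPolynomial (Fin n) ℝ} (hC : 1 ≤ C)
    (hsupp : p'.support ⊆ p.support) (hcoeff : ∀ r, realSize (p'.coeff r) ≤ C) :
    polySize p' ≤ C * polySize p := by
  have hdeg : ∀ i, p'.degreeOf i ≤ p.degreeOf i := fun i => by
    simp only [MvPolynomial.degreeOf_eq_sup]
    exact Finset.sup_mono hsupp
  refine (Finset.sum_le_sum_of_subset (Fintype.piFinset_subset _ _ fun _ =>
    Finset.range_mono (Nat.succ_le_succ (Finset.sup_mono_fun fun i _ => hdeg i)))).trans ?_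
  rw [polySize, Finset.mul_sum]
  refine Finset.sum_le_sum fun r _ => ?_
  have h1 := hcoeff (Finsupp.equivFunOnFinite.symm r)
  have h2 := Nat.mul_le_mul_left C (one_le_realSize (p.coeff (Finsupp.equivFunOnFinite.symm r)))
  nlinarith [Nat.zero_le (∑ i, ratSize (r i : ℚ) + n)]

theorem card_support_le_polyShapeSize {n : ℕ} (p : MvPolynomial (Fin n) ℝ) :
    p.support.card ≤ polyShapeSize p := by
  rw [Finset.card_eq_sum_ones]
  exact Finset.sum_le_sum fun r _ => by omega

/-- The number of variables alone is not bounded by the size (take `p = 0`), but in the coefficient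
estimate it occurs only multiplied by the number of monomials. -/
theorem card_support_mul_le_polyShapeSize {n : ℕ} (p : MvPolynomial (Fin n) ℝ) :
    p.support.card * n ≤ polyShapeSize p := by
  rw [← smul_eq_mul]
  exact Finset.card_nsmul_le_sum _ _ _ fun r _ => by omega

theorem polyShapeSize_le_polySize {n : ℕ} (p : MvPolynomial (Fin n) ℝ) :
    polyShapeSize p ≤ polySize p := by
  rw [polyShapeSize, polySize]
  refine (Finset.sum_le_sum (g := fun r => realSize (p.coeff r) + ∑ i, ratSize (r i : ℚ) + n)
    fun r _ => by have := one_le_realSize (p.coeff r); omega).trans ?_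
  have hmap : ∑ r ∈ p.support, (realSize (p.coeff r) + ∑ i, ratSize (r i : ℚ) + n)
      = ∑ r ∈ p.support.map Finsupp.equivFunOnFinite.toEmbedding,
        (realSize (p.coeff (Finsupp.equivFunOnFinite.symm r)) + ∑ i, ratSize (r i : ℚ) + n) := by
    simp [Finset.sum_map]
  rw [hmap]
  refine Finset.sum_le_sum_of_subset fun r hr => ?_
  obtain ⟨s, hs, rfl⟩ := Finset.mem_map.1 hr
  rw [Fintype.mem_piFinset]
  intro i
  rw [Finset.mem_range, Nat.lt_succ_iff]
  exact (MvPolynomial.le_degreeOf_of_mem_support i hs).trans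
    (Finset.le_sup (f := fun i => p.degreeOf i) (Finset.mem_univ i))

/-- The dense measure counts all `(k + 1) ^ n` grid points, each with weight at least `n`. This is
why the bound on `size` needs no degree term, unlike the sparse one, where exponents are measured by
bit length. -/
theorem totalDegree_le_polySize {n : ℕ} (p : MvPolynomial (Fin n) ℝ) :
    p.totalDegree ≤ polySize p := by
  set k := Finset.univ.sup fun i => p.degreeOf i with hk
  have h1 : p.totalDegree ≤ n * k := by
    refine Finset.sup_le fun s hs => ?_
    rw [Finsupp.sum_fintype _ _ (by simp)]
    refine (Finset.sum_le_card_nsmul _ _ k fun i _ => ?_).trans (by simp)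
    exact (MvPolynomial.le_degreeOf_of_mem_support i hs).trans
      (Finset.le_sup (f := fun i => p.degreeOf i) (Finset.mem_univ i))
  refine h1.trans ?_
  have h2 : (k + 1) ^ n * n ≤ polySize p := by
    have := Finset.card_nsmul_le_sum (Fintype.piFinset fun _ : Fin n => Finset.range (k + 1))
      (fun r => realSize (p.coeff (Finsupp.equivFunOnFinite.symm r)) + ∑ i, ratSize (r i : ℚ) + n)
      n fun r _ => by omega
    simpa [polySize] using this
  refine le_trans ?_ h2
  rcases Nat.eq_zero_or_pos n with rfl | hn
  · simp
  · rw [mul_comm]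
    exact Nat.mul_le_mul_right _ ((Nat.le_succ k).trans (Nat.le_self_pow hn.ne' _))

/-! ### Polynomial constraints -/

namespace PC

/-- Replace every polynomial of a constraint. -/
noncomputable def mapPoly {n : ℕ} (f : MvPolynomial (Fin n) ℝ → MvPolynomial (Fin n) ℝ) :
    PC n → PC n
  | pos p => pos (f p)
  | nonneg p => nonneg (f p)
  | conj k β => conj k fun i => (β i).mapPoly f
  | disj k β => disj k fun i => (β i).mapPoly f

variable {n : ℕ} {f : MvPolynomial (Fin n) ℝ → MvPolynomial (Fin n) ℝ}

theorem isRational_mapPoly (hf : ∀ p r, ∃ a : ℚ, (a : ℝ) = (f p).coeff r) (α : PC n) :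
    (α.mapPoly f).IsRational := by
  induction α with
  | pos p => exact hf p
  | nonneg p => exact hf p
  | conj k β ih => exact ih
  | disj k β ih => exact ih

theorem accepts_mapPoly_iff {x : Fin n → ℚ}
    (hf : ∀ p, (0 ≤ MvPolynomial.eval (fun i => (x i : ℝ)) p ↔
        0 ≤ MvPolynomial.eval (fun i => (x i : ℝ)) (f p)) ∧
      (0 < MvPolynomial.eval (fun i => (x i : ℝ)) p ↔
        0 < MvPolynomial.eval (fun i => (x i : ℝ)) (f p))) (α : PC n) :
    α.Accepts x ↔ (α.mapPoly f).Accepts x := by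
  induction α with
  | pos p => exact (hf p).2
  | nonneg p => exact (hf p).1
  | conj k β ih => exact forall_congr' ih
  | disj k β ih => exact exists_congr ih

/-- `S` and `D` are global bounds for the whole constraint, so that a single factor `C` works at
every atom and passes through the induction. -/
theorem sizeWith_mapPoly_le {s s' : MvPolynomial (Fin n) ℝ → ℕ} {C S D : ℕ} (hC : 1 ≤ C)
    (hf : ∀ p, s p ≤ S → p.totalDegree ≤ D → s' (f p) ≤ C * s p) (α : PC n)
    (hS : α.sizeWith s ≤ S) (hD : α.degree ≤ D) :
    (α.mapPoly f).sizeWith s' ≤ C * α.sizeWith s := by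
  have hsum : ∀ (k : ℕ) (β : Fin k → PC n),
      (∀ i, (β i).sizeWith s ≤ S → (β i).degree ≤ D →
        ((β i).mapPoly f).sizeWith s' ≤ C * (β i).sizeWith s) →
      k + ∑ i, (β i).sizeWith s ≤ S → (Finset.univ.sup fun i => (β i).degree) ≤ D →
      k + ∑ i, ((β i).mapPoly f).sizeWith s' ≤ C * (k + ∑ i, (β i).sizeWith s) := by
    intro k β ih hS hD
    rw [mul_add, Finset.mul_sum]
    refine Nat.add_le_add (Nat.le_mul_of_pos_left k hC) (Finset.sum_le_sum fun i hi => ih i ?_ ?_)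
    · have := Finset.single_le_sum (f := fun i => (β i).sizeWith s) (fun _ _ => Nat.zero_le _) hi
      omega
    · exact (Finset.le_sup (f := fun i => (β i).degree) hi).trans hD
  induction α with
  | pos p =>
    simp only [sizeWith, mapPoly, degree] at *
    have := hf p (by omega) hD
    rw [mul_add]
    omega
  | nonneg p =>
    simp only [sizeWith, mapPoly, degree] at *
    have := hf p (by omega) hD
    rw [mul_add]
    omega
  | conj k β ih => exact hsum k β ih hS hD
  | disj k β ih => exact hsum k β ih hS hD

end PC

theorem coefficient_bound {m N n D S T : ℕ} (hN : N ≤ S) (hn : N * n ≤ S) (hm : m ≤ T)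
    (hD : D ≤ T) (hS : S ≤ T) (hT : 1 ≤ T) : N * N + m * n * D * N + 3 ≤ 5 * T ^ 3 := by
  have h1 : N * N ≤ T ^ 3 := calc
    N * N ≤ T * T * 1 := by rw [mul_one]; exact Nat.mul_le_mul (hN.trans hS) (hN.trans hS)
    _ ≤ T * T * T := Nat.mul_le_mul_left _ hT
    _ = T ^ 3 := by ring
  have h2 : m * n * D * N ≤ T ^ 3 := calc
    -- Grouping `n` with `N` avoids any bound on `n` itself.
    m * n * D * N = m * D * (N * n) := by ring
    _ ≤ T * T * T := Nat.mul_le_mul (Nat.mul_le_mul hm hD) (hn.trans hS)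
    _ = T ^ 3 := by ring
  have h3 : 1 ≤ T ^ 3 := Nat.one_le_pow _ _ hT
  omega

theorem exists_rational_constraint (n m : ℕ) (α : PC n) : ∃ α' : PC n,
    α'.IsRational ∧
    α.sem ∩ boundedPoints n m = α'.sem ∩ boundedPoints n m ∧
    α'.size ≤ 5 * (m + α.size + 1) ^ 5 ∧
    α'.sparseSize ≤ 5 * (m + α.degree + α.shapeSize + 1) ^ 5 := by
  -- The replacement depends only on `n`, `m` and the polynomial, so one constraint satisfies both
  -- size bounds.
  choose f hrat hsupp hcoeff hsign using exists_int_polynomial_same_signs (n := n) m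
  have hpow : ∀ {S' S T : ℕ}, S' ≤ 5 * T ^ 3 * S → S ≤ T → 1 ≤ T → S' ≤ 5 * T ^ 5 := by
    intro S' S T h hS hT
    calc S' ≤ 5 * T ^ 3 * S := h
      _ ≤ 5 * T ^ 3 * T := Nat.mul_le_mul_left _ hS
      _ = 5 * T ^ 4 := by ring
      _ ≤ 5 * T ^ 5 := Nat.mul_le_mul_left _ (Nat.pow_le_pow_right hT (by norm_num))
  have hone : ∀ {T : ℕ}, 1 ≤ T → 1 ≤ 5 * T ^ 3 := fun {T} hT => by
    have := Nat.one_le_pow 3 T hT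
    omega
  refine ⟨α.mapPoly f, PC.isRational_mapPoly hrat α, ?_, ?_, ?_⟩
  · ext x
    simp only [Set.mem_inter_iff, PC.sem, Set.mem_ofPred_eq]
    exact and_congr_left fun hx => PC.accepts_mapPoly_iff (fun p => hsign p x hx) α
  · set T := m + α.size + 1 with hT
    refine hpow (PC.sizeWith_mapPoly_le (s := polySize) (s' := polySize) (hone (by omega))
      (fun p hp _ => polySize_le (hone (by omega)) (hsupp p) fun r => (hcoeff p r).trans ?_)
      α le_rfl le_rfl) (show α.size ≤ T by omega) (by omega)
    have h1 := polyShapeSize_le_polySize p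
    change polySize p ≤ α.size at hp
    exact coefficient_bound ((card_support_le_polyShapeSize p).trans h1)
      ((card_support_mul_le_polyShapeSize p).trans h1) (by omega)
      ((totalDegree_le_polySize p).trans (by omega)) (by omega) (by omega)
  · set T := m + α.degree + α.shapeSize + 1 with hT
    refine hpow (PC.sizeWith_mapPoly_le (s := polyShapeSize) (s' := polySparseSize)
      (hone (by omega)) (fun p hp hd => polySparseSize_le (hone (by omega)) (hsupp p)
        fun r => (hcoeff p r).trans ?_)
      α le_rfl le_rfl) (show α.shapeSize ≤ T by omega) (by omega)
    change polyShapeSize p ≤ α.shapeSize at hp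
    exact coefficient_bound (card_support_le_polyShapeSize p)
      (card_support_mul_le_polyShapeSize p) (by omega) (by omega) (by omega) (by omega)

end RatPC

theorem mainTheorem5 :
    (∃ K : ℕ, ∀ (t m : ℕ) (c : Fin t → ℝ), ∃ c' : Fin t → ℚ,
      RatPC.vecSize c' ≤ K * ((m + 1) * t) ^ K ∧
      RatPC.SameIneqs m c (fun i => (c' i : ℝ))) ∧
    (∃ K : ℕ, ∀ (n m : ℕ) (α : RatPC.PC n), ∃ α' : RatPC.PC n,
      α'.IsRational ∧
      α.sem ∩ RatPC.boundedPoints n m = α'.sem ∩ RatPC.boundedPoints n m ∧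
      α'.size ≤ K * (m + α.size + 1) ^ K ∧
      α'.sparseSize ≤ K * (m + α.degree + α.shapeSize + 1) ^ K) :=
  ⟨⟨13, RatPC.exists_rat_vector_sameIneqs⟩, ⟨5, RatPC.exists_rational_constraint⟩⟩
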